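/- For $n\ge 1$ let $F_{n-1,n}=\prod_{i=2}^{n}(x_{i,1}+\cdots+x_{i,n})$, and let $\mathrm{ST}_n=\sum_{\nu\in T_n}x_{2,\nu(2)}x_{3,\nu(3)}\cdots x_{n,\nu(n)}$ be the spanning tree polynomial of the complete graph on $\{1,\dots,n\}$, where $T_n$ is the set of maps $\nu:\{2,\dots,n\}\to\{1,\dots,n\}$ such that $\nu(i)\neq i$ for all $i$ and, for every $i$, some iterate satisfies $\nu^{k}(i)=1$ (that is, the edges $i\to\nu(i)$ form a spanning tree directed towards the root $1$). A monotone circuit is an arithmetic circuit over $\mathbb{R}$ with addition and multiplication gates (of arbitrary fan-in) whose inputs are variables and nonnegative real constants; its size is its number of gates. There exist constants $\eta>0$, $c>0$ and $n_0$ such that for all $n\ge n_0$ and all real $\epsilon\ge 2^{-\eta n}$, every monotone circuit computing $F_{n-1,n}-\epsilon\cdot \mathrm{ST}_n$ and every monotone circuit computing $F_{n-1,n}+\epsilon\cdot \mathrm{ST}_n$ has size at least $2^{cn}$. (If $\epsilon>1$, the first polynomial may have negative coefficients; then no monotone circuit computes it and its monotone complexity is infinite.) -/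

import Mathlib

noncomputable section

/-- An input wire of a gate that may read `k` earlier gates: a nonnegative real constant,
a variable, or one of the earlier gates. -/
inductive MonotoneSource (σ : Type) (k : ℕ) : Type
  | const (c : NNReal) : MonotoneSource σ k
  | var (x : σ) : MonotoneSource σ k
  | gate (j : Fin k) : MonotoneSource σ k

/-- A gate: the sum or the product of its inputs. The fan-in is arbitrary, and the same input may
be used several times, so that circuits of fan-in two are a special case. -/
inductive MonotoneGate (σ : Type) (k : ℕ) : Type
  | add (l : List (MonotoneSource σ k)) : MonotoneGate σ k
  | mul (l : List (MonotoneSource σ k)) : MonotoneGate σ k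

/-- A monotone arithmetic circuit over the reals in the variables `σ`. The directed acyclic graph
of its gates is given in topological order, gate `i` reading only constants, variables and gates
with smaller index. The size is the number of addition and multiplication gates. -/
structure MonotoneCircuit (σ : Type) : Type where
  /-- the number of gates -/
  size : ℕ
  /-- the gates in topological order -/
  gate : (i : Fin size) → MonotoneGate σ i
  /-- the output node -/
  output : MonotoneSource σ size

/-- The polynomial on an input wire, given the polynomials computed at the earlier gates. -/
def MonotoneSource.eval {σ : Type} {k : ℕ} (v : Fin k → MvPolynomial σ ℝ) :
    MonotoneSource σ k → MvPolynomial σ ℝ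
  | .const c => MvPolynomial.C (c : ℝ)
  | .var x => MvPolynomial.X x
  | .gate j => v j

/-- The polynomial at a gate, given the polynomials computed at the earlier gates. -/
def MonotoneGate.eval {σ : Type} {k : ℕ} (v : Fin k → MvPolynomial σ ℝ) :
    MonotoneGate σ k → MvPolynomial σ ℝ
  | .add l => (l.map (MonotoneSource.eval v)).sum
  | .mul l => (l.map (MonotoneSource.eval v)).prod

/-- The polynomial computed at gate `i` of a circuit. -/
def MonotoneCircuit.value {σ : Type} (C : MonotoneCircuit σ) (i : Fin C.size) :
    MvPolynomial σ ℝ :=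
  (C.gate i).eval (fun j : Fin i => C.value ⟨j, j.isLt.trans i.isLt⟩)
termination_by i.val
decreasing_by exact j.isLt

/-- The circuit `C` computes the polynomial `p`. -/
def MonotoneCircuit.Computes {σ : Type} (C : MonotoneCircuit σ) (p : MvPolynomial σ ℝ) : Prop :=
  C.output.eval C.value = p

/-- The full set-multilinear polynomial `∏_{i ≠ r} ∑_j x_{i,j}` on a vertex set `V` with a
distinguished vertex `r`. For `V = {1, …, n}` and `r = 1` this is `F_{n-1,n}`. -/
def fullSetMultilinear (V : Type) [Fintype V] [DecidableEq V] (r : V) :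
    MvPolynomial (V × V) ℝ :=
  ∏ i : {v : V // v ≠ r}, ∑ j : V, MvPolynomial.X (i.1, j)

/-- The map `ν`, defined on all vertices but `r`, extended by `r ↦ r`. -/
def extendByRoot {V : Type} [DecidableEq V] (r : V) (ν : {v : V // v ≠ r} → V) (v : V) : V :=
  if h : v = r then r else ν ⟨v, h⟩

/-- `ν` is a spanning tree of the graph `G` directed towards the root `r`: every edge `(i, ν i)`
is an edge of `G`, and iterating `ν` from any vertex leads to `r`. -/
def IsRootedSpanningTree {V : Type} [DecidableEq V] (G : SimpleGraph V) (r : V)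
    (ν : {v : V // v ≠ r} → V) : Prop :=
  (∀ i, G.Adj i.1 (ν i)) ∧ ∀ v : V, ∃ k : ℕ, (extendByRoot r ν)^[k] v = r

open Classical in
/-- The spanning tree polynomial of the graph `G` with root `r`. -/
def spanningTreePoly {V : Type} [Fintype V] [DecidableEq V] (G : SimpleGraph V) (r : V) :
    MvPolynomial (V × V) ℝ :=
  ∑ ν : {v : V // v ≠ r} → V with IsRootedSpanningTree G r ν,
    ∏ i : {v : V // v ≠ r}, MvPolynomial.X (i.1, ν i)

end

/-! Both polynomials have the form F + δ·ST with |δ| = ε, and one argument treats both signs. A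
monotone circuit of size s writes such a polynomial as a sum of s products P·Q with nonnegative
coefficients (`MonotoneCircuit.exists_decomposition`). Nothing cancels, so in every nonzero product
P lives on the rows of a set A and Q on the other rows, where A holds between one and two thirds of
the N = n - 1 rows (`exists_rows_of_mul`).

The products are tested against a signed measure. Choose m disjoint triples of non-root vertices. In
each triple a vertex points to the next one or to the root according to a bit; all other vertices
point to the root. The map is a tree unless some triple is a cycle. A triple has weight -1 if it is
a cycle and 3 otherwise, so F integrates to (7·3 - 1)^m = 20^m and ST to 21^m. Against a product
P·Q, a triple that meets both A and its complement contributes a factor of at most 20, any other at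
most 7·3 + 1 = 22. These factors multiply because they bound a norm that tensorizes
(`WeightedNormLE.pi`).

Since A is balanced, the average factor of a random triple is at most 62/3 < 21. Hence each product
accounts for at most (1 + ε)(62/3)^m on average, while ε·21^m has to be reached, up to the 20^m of
F. For m a small fraction of n this makes s exponential, even if ε is exponentially small. -/

noncomputable section

open MvPolynomial

/-! ### Circuit values with nonnegative coefficients -/

/-- The value of an input wire as a polynomial with nonnegative coefficients. -/
def MonotoneSource.evalNN {σ : Type} {k : ℕ} (v : Fin k → MvPolynomial σ NNReal) :
    MonotoneSource σ k → MvPolynomial σ NNReal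
  | .const c => C c
  | .var x => X x
  | .gate j => v j

/-- The value of a gate as a polynomial with nonnegative coefficients. -/
def MonotoneGate.evalNN {σ : Type} {k : ℕ} (v : Fin k → MvPolynomial σ NNReal) :
    MonotoneGate σ k → MvPolynomial σ NNReal
  | .add l => (l.map (MonotoneSource.evalNN v)).sum
  | .mul l => (l.map (MonotoneSource.evalNN v)).prod

/-- The values at the gates of a circuit when the operation `φ` is applied after every gate. -/
def MonotoneCircuit.filteredValue {σ : Type} (C : MonotoneCircuit σ)
    (φ : MvPolynomial σ NNReal → MvPolynomial σ NNReal) (i : Fin C.size) :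
    MvPolynomial σ NNReal :=
  φ ((C.gate i).evalNN (fun j : Fin i => C.filteredValue φ ⟨j, j.isLt.trans i.isLt⟩))
termination_by i.val
decreasing_by exact j.isLt

theorem MonotoneSource.map_evalNN {σ : Type} {k : ℕ} (v : Fin k → MvPolynomial σ NNReal)
    (s : MonotoneSource σ k) :
    map NNReal.toRealHom (s.evalNN v) = s.eval (fun j => map NNReal.toRealHom (v j)) := by
  cases s <;> simp [MonotoneSource.evalNN, MonotoneSource.eval]

theorem MonotoneGate.map_evalNN {σ : Type} {k : ℕ} (v : Fin k → MvPolynomial σ NNReal)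
    (g : MonotoneGate σ k) :
    map NNReal.toRealHom (g.evalNN v) = g.eval (fun j => map NNReal.toRealHom (v j)) := by
  cases g <;>
    simp only [MonotoneGate.evalNN, MonotoneGate.eval, map_list_sum, map_list_prod, List.map_map] <;>
    congr 1 <;>
    exact List.map_congr_left fun s _ => s.map_evalNN v

theorem MonotoneCircuit.map_filteredValue_id {σ : Type} (C : MonotoneCircuit σ) (i : Fin C.size) :
    map NNReal.toRealHom (C.filteredValue id i) = C.value i := by
  obtain ⟨i, hi⟩ := i
  induction i using Nat.strong_induction_on with
  | _ i ih =>
    rw [MonotoneCircuit.filteredValue, MonotoneCircuit.value, id, MonotoneGate.map_evalNN]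
    congr 1
    funext j
    exact ih j j.isLt _

/-! ### Cutting gates of high degree: decomposition into balanced products -/

/-- `a` exceeds `b` by an element of the ideal `I`. -/
def ExceedsBy {R : Type*} [CommSemiring R] (I : Ideal R) (a b : R) : Prop :=
  ∃ k ∈ I, a = b + k

theorem ExceedsBy.refl {R : Type*} [CommSemiring R] (I : Ideal R) (a : R) : ExceedsBy I a a :=
  ⟨0, I.zero_mem, by simp⟩

theorem ExceedsBy.add {R : Type*} [CommSemiring R] {I : Ideal R} {a b c d : R}
    (h : ExceedsBy I a b) (h' : ExceedsBy I c d) : ExceedsBy I (a + c) (b + d) := by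
  obtain ⟨k, hk, rfl⟩ := h
  obtain ⟨l, hl, rfl⟩ := h'
  exact ⟨k + l, I.add_mem hk hl, by ring⟩

theorem ExceedsBy.mul {R : Type*} [CommSemiring R] {I : Ideal R} {a b c d : R}
    (h : ExceedsBy I a b) (h' : ExceedsBy I c d) : ExceedsBy I (a * c) (b * d) := by
  obtain ⟨k, hk, rfl⟩ := h
  obtain ⟨l, hl, rfl⟩ := h'
  exact ⟨k * (d + l) + b * l, I.add_mem (I.mul_mem_right _ hk) (I.mul_mem_left _ hl), by ring⟩

theorem ExceedsBy.list_sum {R α : Type*} [CommSemiring R] {I : Ideal R} {f g : α → R}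
    (l : List α) (h : ∀ x ∈ l, ExceedsBy I (f x) (g x)) :
    ExceedsBy I (l.map f).sum (l.map g).sum := by
  induction l with
  | nil => exact .refl I _
  | cons a l ih =>
    simp only [List.map_cons, List.sum_cons]
    exact (h a (by simp)).add (ih fun x hx => h x (by simp [hx]))

theorem ExceedsBy.list_prod {R α : Type*} [CommSemiring R] {I : Ideal R} {f g : α → R}
    (l : List α) (h : ∀ x ∈ l, ExceedsBy I (f x) (g x)) :
    ExceedsBy I (l.map f).prod (l.map g).prod := by
  induction l with
  | nil => exact .refl I _
  | cons a l ih =>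
    simp only [List.map_cons, List.prod_cons]
    exact (h a (by simp)).mul (ih fun x hx => h x (by simp [hx]))

theorem MonotoneSource.exceedsBy_evalNN {σ : Type} {k : ℕ} {I : Ideal (MvPolynomial σ NNReal)}
    {v v' : Fin k → MvPolynomial σ NNReal} (h : ∀ j, ExceedsBy I (v j) (v' j))
    (s : MonotoneSource σ k) : ExceedsBy I (s.evalNN v) (s.evalNN v') := by
  cases s with
  | gate j => exact h j
  | _ => exact .refl I _

theorem MonotoneGate.exceedsBy_evalNN {σ : Type} {k : ℕ} {I : Ideal (MvPolynomial σ NNReal)}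
    {v v' : Fin k → MvPolynomial σ NNReal} (h : ∀ j, ExceedsBy I (v j) (v' j))
    (g : MonotoneGate σ k) : ExceedsBy I (g.evalNN v) (g.evalNN v') := by
  cases g with
  | add l => exact .list_sum l fun s _ => s.exceedsBy_evalNN h
  | mul l => exact .list_prod l fun s _ => s.exceedsBy_evalNN h

open Classical in
/-- The polynomial `p` if its degree is less than `d / 3`, and `0` otherwise. -/
def cutDegree {σ : Type} (d : ℕ) (p : MvPolynomial σ NNReal) : MvPolynomial σ NNReal :=
  if 3 * p.totalDegree < d then p else 0

theorem totalDegree_cutDegree {σ : Type} {d : ℕ} (hd : 0 < d) (p : MvPolynomial σ NNReal) :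
    3 * (cutDegree d p).totalDegree < d := by
  unfold cutDegree
  split_ifs with h
  · exact h
  · simpa using hd

theorem MonotoneCircuit.totalDegree_filteredValue {σ : Type} (C : MonotoneCircuit σ) {d : ℕ}
    (hd : 0 < d) (i : Fin C.size) : 3 * (C.filteredValue (cutDegree d) i).totalDegree < d := by
  rw [MonotoneCircuit.filteredValue]
  exact totalDegree_cutDegree hd _

theorem MonotoneSource.totalDegree_evalNN {σ : Type} {k d : ℕ} (hd : 3 < d)
    {v : Fin k → MvPolynomial σ NNReal} (h : ∀ j, 3 * (v j).totalDegree < d)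
    (s : MonotoneSource σ k) : 3 * (s.evalNN v).totalDegree < d := by
  cases s with
  | const c => simp [MonotoneSource.evalNN]; omega
  | var x => simpa only [MonotoneSource.evalNN, totalDegree_X, mul_one] using hd
  | gate j => exact h j

/-- A product of factors of degree less than `d / 3` whose degree is at least `d / 3` has a partial
product of degree between `d / 3` and `2 d / 3`. -/
theorem exists_factor_of_list_prod {σ : Type} {d : ℕ} (hd : 0 < d)
    (l : List (MvPolynomial σ NNReal))
    (h : ∀ p ∈ l, 3 * p.totalDegree < d) (hl : d ≤ 3 * l.prod.totalDegree) :
    ∃ P S, l.prod = P * S ∧ d ≤ 3 * P.totalDegree ∧ 3 * P.totalDegree < 2 * d := by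
  induction l with
  | nil => exact ⟨1, 1, by simp, hl, by simpa using hd⟩
  | cons a l ih =>
    by_cases hc : d ≤ 3 * l.prod.totalDegree
    · obtain ⟨P, S, h1, h2⟩ := ih (fun p hp => h p (by simp [hp])) hc
      exact ⟨P, a * S, by rw [List.prod_cons, h1]; ring, h2⟩
    -- The threshold is first crossed here, and the new factor `a` overshoots it by less than d / 3.
    · refine ⟨(a :: l).prod, 1, by simp, hl, ?_⟩
      have h1 := totalDegree_mul a l.prod
      have h2 := h a (by simp)
      rw [List.prod_cons]
      omega

/-- Sums of polynomials of degree below d / 3 stay below it, so only a multiplication gate can cross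
the threshold. The condition `3 < d` keeps single variables below it. -/
theorem MonotoneGate.exists_factor {σ : Type} {k d : ℕ} (hd : 3 < d)
    {v : Fin k → MvPolynomial σ NNReal} (h : ∀ j, 3 * (v j).totalDegree < d)
    (g : MonotoneGate σ k) (hg : d ≤ 3 * (g.evalNN v).totalDegree) :
    ∃ P S, g.evalNN v = P * S ∧ d ≤ 3 * P.totalDegree ∧ 3 * P.totalDegree < 2 * d := by
  cases g with
  | add l =>
    exfalso
    have : ∀ l : List (MonotoneSource σ k),
        3 * (l.map (MonotoneSource.evalNN v)).sum.totalDegree < d := by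
      intro l
      induction l with
      | nil => simp; omega
      | cons a l ih =>
        rw [List.map_cons, List.sum_cons]
        have h1 := totalDegree_add (a.evalNN v) (l.map (MonotoneSource.evalNN v)).sum
        have h2 := a.totalDegree_evalNN hd h
        rcases le_max_iff.1 h1 with h3 | h3 <;> omega
    exact absurd (this l) (not_lt.2 hg)
  | mul l =>
    refine exists_factor_of_list_prod (by omega) _ (fun p hp => ?_) hg
    obtain ⟨s, -, rfl⟩ := List.mem_map.1 hp
    exact s.totalDegree_evalNN hd h

/-- A monotone circuit of size `s` for a homogeneous polynomial of degree `d` yields a decomposition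
into `s` monotone products with a factor of degree between `d / 3` and `2 d / 3`. -/
theorem MonotoneCircuit.exists_decomposition {σ : Type} (C : MonotoneCircuit σ)
    {f : MvPolynomial σ ℝ} (hC : C.Computes f) {d : ℕ} (hd : 3 < d) (hf : f.IsHomogeneous d) :
    ∃ P Q : Fin C.size → MvPolynomial σ NNReal,
      map NNReal.toRealHom (∑ g, P g * Q g) = f ∧
      ∀ g, Q g = 0 ∨ d ≤ 3 * (P g).totalDegree ∧ 3 * (P g).totalDegree < 2 * d := by
  classical
  set v' := C.filteredValue (cutDegree d) with hv'
  set w : Fin C.size → MvPolynomial σ NNReal := fun i =>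
    (C.gate i).evalNN (fun j : Fin i => v' ⟨j, j.isLt.trans i.isLt⟩) with hw
  have hvw : ∀ i, v' i = cutDegree d (w i) := fun i => by
    rw [hv', MonotoneCircuit.filteredValue]
  have hsmall : ∀ i, 3 * (v' i).totalDegree < d := C.totalDegree_filteredValue (by omega)
  -- The ideal is generated by the values that are cut, each computed from inputs already filtered;
  -- replacing them by `0` changes every later value by an element of it.
  set I := Ideal.span (Set.range fun g => if 3 * (w g).totalDegree < d then 0 else w g) with hI
  have hex : ∀ i, ExceedsBy I (C.filteredValue id i) (v' i) := by
    rintro ⟨i, hi⟩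
    induction i using Nat.strong_induction_on with
    | _ i ih =>
      have h1 : ExceedsBy I (C.filteredValue id ⟨i, hi⟩) (w ⟨i, hi⟩) := by
        rw [MonotoneCircuit.filteredValue, id]
        exact MonotoneGate.exceedsBy_evalNN (fun j => ih j j.isLt _) _
      rw [hvw, cutDegree]
      split_ifs with h
      · exact h1
      · obtain ⟨k, hk, h1⟩ := h1
        refine ⟨w ⟨i, hi⟩ + k, I.add_mem (Ideal.subset_span ⟨⟨i, hi⟩, ?_⟩) hk, by rw [h1, zero_add]⟩
        simp only [h, if_false]
  obtain ⟨k, hk, hout⟩ := C.output.exceedsBy_evalNN hex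
  have hmap : map NNReal.toRealHom (C.output.evalNN (C.filteredValue id)) = f := by
    rw [MonotoneSource.map_evalNN, ← hC]
    congr 1
    funext i
    exact C.map_filteredValue_id i
  -- What survives the cuts has degree below d / 3, yet by positivity each of its monomials would
  -- occur in `f`, which is homogeneous of degree `d`.
  have hzero : C.output.evalNN v' = 0 := by
    have hs := C.output.totalDegree_evalNN hd hsmall
    refine MvPolynomial.ext _ _ fun m => ?_
    by_contra hm
    rw [coeff_zero] at hm
    have h1 : coeff m f ≠ 0 := by
      rw [← hmap, coeff_map, hout, coeff_add]
      exact fun h0 => hm (add_eq_zero.1 (NNReal.coe_eq_zero.1 h0)).1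
    have h2 := hf h1
    have h3 := le_totalDegree (mem_support_iff.2 hm)
    have h4 : (m.sum fun _ e => e) = d := by
      rw [← h2, Finsupp.weight_apply]
      simp
    omega
  obtain ⟨c, hc⟩ := Ideal.mem_span_range_iff_exists_fun.1 hk
  have hfac : ∀ g, ∃ P S : MvPolynomial σ NNReal,
      (if 3 * (w g).totalDegree < d then 0 else w g) = P * S ∧
      (S = 0 ∨ d ≤ 3 * P.totalDegree ∧ 3 * P.totalDegree < 2 * d) := by
    intro g
    split_ifs with h
    · exact ⟨0, 0, by simp, Or.inl rfl⟩
    · obtain ⟨P, S, h1, h2⟩ := MonotoneGate.exists_factor hd (fun j => hsmall _) (C.gate g)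
        (not_lt.1 h)
      exact ⟨P, S, h1, Or.inr h2⟩
  choose P S hPS hdeg using hfac
  refine ⟨P, fun g => c g * S g, ?_, fun g => (hdeg g).imp (fun h => by simp [h]) id⟩
  rw [← hmap, hout, hzero, zero_add, ← hc]
  congr 1
  refine Finset.sum_congr rfl fun g _ => ?_
  rw [hPS]
  ring

/-! ### A matrix norm that is multiplicative under tensor products -/

/-- The matrix `K` has norm at most `lam` from the `L²` space of some probability weight on `Y` to
the dual of the `L²` space of some positive probability weight on `X`. -/
def WeightedNormLE {X Y : Type*} [Fintype X] [Fintype Y] (K : X → Y → ℝ) (lam : ℝ) : Prop :=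
  ∃ (d : X → ℝ) (e : Y → ℝ), (∀ x, 0 < d x) ∧ (∀ y, 0 ≤ e y) ∧ ∑ x, d x = 1 ∧ ∑ y, e y = 1 ∧
    ∀ b : Y → ℝ, ∑ x, (∑ y, K x y * b y) ^ 2 / d x ≤ lam ^ 2 * ∑ y, e y * b y ^ 2

/-- Apply the bound for `K'` in the second coordinates and that for `K` in the first. The bilinear
bound of `WeightedNormLE.abs_sum_le` need not be multiplicative, which is why the stronger weighted
norm is carried along. -/
theorem WeightedNormLE.prod {X Y X' Y' : Type*} [Fintype X] [Fintype Y] [Fintype X'] [Fintype Y']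
    {K : X → Y → ℝ} {K' : X' → Y' → ℝ} {l l' : ℝ} (h : WeightedNormLE K l)
    (h' : WeightedNormLE K' l') :
    WeightedNormLE (fun (x : X × X') (y : Y × Y') => K x.1 y.1 * K' x.2 y.2) (l * l') := by
  obtain ⟨d, e, hd, he, hd1, he1, hK⟩ := h
  obtain ⟨d', e', hd', he', hd1', he1', hK'⟩ := h'
  refine ⟨fun x => d x.1 * d' x.2, fun y => e y.1 * e' y.2, fun x => mul_pos (hd _) (hd' _),
    fun y => mul_nonneg (he _) (he' _), ?_, ?_, fun b => ?_⟩
  · rw [Fintype.sum_prod_type, ← Fintype.sum_mul_sum, hd1, hd1', one_mul]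
  · rw [Fintype.sum_prod_type, ← Fintype.sum_mul_sum, he1, he1', one_mul]
  · set z : Y → X' → ℝ := fun y x' => ∑ y', K' x' y' * b (y, y') with hz
    calc ∑ x : X × X', (∑ y : Y × Y', K x.1 y.1 * K' x.2 y.2 * b y) ^ 2 / (d x.1 * d' x.2)
        = ∑ x', (∑ x, (∑ y, K x y * z y x') ^ 2 / d x) / d' x' := by
          rw [Fintype.sum_prod_type_right]
          refine Finset.sum_congr rfl fun x' _ => ?_
          rw [Finset.sum_div]
          refine Finset.sum_congr rfl fun x _ => ?_
          rw [div_div, Fintype.sum_prod_type]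
          simp only [hz, Finset.mul_sum, mul_assoc]
      _ ≤ ∑ x', (l ^ 2 * ∑ y, e y * z y x' ^ 2) / d' x' :=
          Finset.sum_le_sum fun x' _ => div_le_div_of_nonneg_right (hK _) (hd' x').le
      _ = l ^ 2 * ∑ y, e y * ∑ x', z y x' ^ 2 / d' x' := by
          simp only [Finset.mul_sum, Finset.sum_div]
          rw [Finset.sum_comm]
          refine Finset.sum_congr rfl fun y _ => Finset.sum_congr rfl fun x' _ => ?_
          ring
      _ ≤ l ^ 2 * ∑ y, e y * (l' ^ 2 * ∑ y', e' y' * b (y, y') ^ 2) := by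
          refine mul_le_mul_of_nonneg_left (Finset.sum_le_sum fun y _ => ?_) (sq_nonneg l)
          exact mul_le_mul_of_nonneg_left (hK' _) (he y)
      _ = (l * l') ^ 2 * ∑ y : Y × Y', e y.1 * e' y.2 * b y ^ 2 := by
          rw [Fintype.sum_prod_type]
          simp only [Finset.mul_sum]
          refine Finset.sum_congr rfl fun y _ => Finset.sum_congr rfl fun y' _ => ?_
          ring

theorem WeightedNormLE.reindex {X Y X' Y' : Type*} [Fintype X] [Fintype Y] [Fintype X'] [Fintype Y']
    {K : X → Y → ℝ} {l : ℝ} (h : WeightedNormLE K l) (f : X' ≃ X) (g : Y' ≃ Y) :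
    WeightedNormLE (fun x y => K (f x) (g y)) l := by
  obtain ⟨d, e, hd, he, hd1, he1, hK⟩ := h
  refine ⟨fun x => d (f x), fun y => e (g y), fun x => hd _, fun y => he _, ?_, ?_, fun b => ?_⟩
  · rw [← hd1]; exact f.sum_comp d
  · rw [← he1]; exact g.sum_comp e
  · have h1 := hK (fun y => b (g.symm y))
    rw [← f.sum_comp, ← g.sum_comp (fun y => e y * _)] at h1
    simp only [← g.sum_comp (fun y => K _ y * _), Equiv.symm_apply_apply] at h1
    exact h1

theorem WeightedNormLE.pi {X Y : Type*} [Fintype X] [Fintype Y] {m : ℕ}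
    {K : Fin m → X → Y → ℝ} {l : Fin m → ℝ} (h : ∀ g, WeightedNormLE (K g) (l g)) :
    WeightedNormLE (fun (x : Fin m → X) (y : Fin m → Y) => ∏ g, K g (x g) (y g)) (∏ g, l g) := by
  induction m with
  | zero =>
    refine ⟨fun _ => 1, fun _ => 1, by simp, by simp, by simp, by simp, fun b => by simp⟩
  | succ m ih =>
    have h1 := ((h 0).prod (ih fun g => h g.succ)).reindex
      (Fin.consEquiv fun _ => X).symm (Fin.consEquiv fun _ => Y).symm
    rw [← Fin.prod_univ_succ] at h1
    convert h1 using 3 with x y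
    rw [Fin.prod_univ_succ]
    rfl

/-- Cauchy–Schwarz with respect to `d`, then the norm bound; for probability weights the L² norms
are at most the sup norms. -/
theorem WeightedNormLE.abs_sum_le {X Y : Type*} [Fintype X] [Fintype Y] {K : X → Y → ℝ} {l : ℝ}
    (h : WeightedNormLE K l) (hl : 0 ≤ l) {u : X → ℝ} {v : Y → ℝ} {U V : ℝ}
    (hu : ∀ x, |u x| ≤ U) (hv : ∀ y, |v y| ≤ V) (hU : 0 ≤ U) (hV : 0 ≤ V) :
    |∑ x, ∑ y, K x y * (u x * v y)| ≤ l * (U * V) := by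
  obtain ⟨d, e, hd, he, hd1, he1, hK⟩ := h
  refine abs_le_of_sq_le_sq ?_ (by positivity)
  have h1 : (∑ x, ∑ y, K x y * (u x * v y)) = ∑ x, u x * ∑ y, K x y * v y := by
    simp only [Finset.mul_sum]
    refine Finset.sum_congr rfl fun x _ => Finset.sum_congr rfl fun y _ => ?_
    ring
  have h2 := Finset.sq_sum_div_le_sum_sq_div Finset.univ (fun x => u x * ∑ y, K x y * v y)
    (fun x _ => hd x)
  rw [hd1, div_one, ← h1] at h2
  calc _ ≤ _ := h2
    _ ≤ ∑ x, U ^ 2 * ((∑ y, K x y * v y) ^ 2 / d x) := by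
      refine Finset.sum_le_sum fun x _ => ?_
      rw [mul_pow, mul_div_assoc]
      have := (hd x).le
      exact mul_le_mul_of_nonneg_right (sq_le_sq' (abs_le.1 (hu x)).1 (abs_le.1 (hu x)).2)
        (by positivity)
    _ ≤ U ^ 2 * (l ^ 2 * ∑ y, e y * v y ^ 2) := by
      rw [← Finset.mul_sum]
      exact mul_le_mul_of_nonneg_left (hK v) (sq_nonneg U)
    _ ≤ U ^ 2 * (l ^ 2 * ∑ y, e y * V ^ 2) := by
      refine mul_le_mul_of_nonneg_left (mul_le_mul_of_nonneg_left
        (Finset.sum_le_sum fun y _ => mul_le_mul_of_nonneg_left ?_ (he y)) (sq_nonneg l))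
        (sq_nonneg U)
      exact sq_le_sq' (abs_le.1 (hv y)).1 (abs_le.1 (hv y)).2
    _ = (l * (U * V)) ^ 2 := by
      rw [← Finset.sum_mul, he1]
      ring

/-- The norm of a matrix is at most the sum of the absolute values of its entries. -/
theorem weightedNormLE_sum_abs {X Y : Type*} [Fintype X] [Fintype Y] (K : X → Y → ℝ) {l : ℝ}
    (hl : 0 < l) (hK : ∑ x, ∑ y, |K x y| = l) (hrow : ∀ x, 0 < ∑ y, |K x y|) :
    WeightedNormLE K l := by
  refine ⟨fun x => (∑ y, |K x y|) / l, fun y => (∑ x, |K x y|) / l, fun x => div_pos (hrow x) hl,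
    fun y => div_nonneg (Finset.sum_nonneg fun _ _ => abs_nonneg _) hl.le, ?_, ?_, fun b => ?_⟩
  · rw [← Finset.sum_div, hK, div_self hl.ne']
  · rw [← Finset.sum_div, Finset.sum_comm, hK, div_self hl.ne']
  · have h1 : ∀ x, (∑ y, K x y * b y) ^ 2 / ((∑ y, |K x y|) / l) ≤ l * ∑ y, |K x y| * b y ^ 2 := by
      intro x
      rw [div_div_eq_mul_div, div_le_iff₀ (hrow x)]
      have h2 : (∑ y, K x y * b y) ^ 2 ≤ (∑ y, |K x y|) * ∑ y, |K x y| * b y ^ 2 :=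
        Finset.sum_sq_le_sum_mul_sum_of_sq_le_mul _ (fun _ _ => abs_nonneg _)
          (fun _ _ => by positivity) fun y _ => by
            rw [mul_pow, ← sq_abs (K x y)]; apply le_of_eq; ring
      nlinarith
    calc _ ≤ ∑ x, l * ∑ y, |K x y| * b y ^ 2 := Finset.sum_le_sum fun x _ => h1 x
      _ = _ := by
        simp only [Finset.mul_sum, Finset.sum_div, Finset.sum_mul]
        rw [Finset.sum_comm]
        refine Finset.sum_congr rfl fun y _ => Finset.sum_congr rfl fun x _ => ?_
        field_simp

/-! ### The matrix of one gadget and of a product of gadgets -/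

open Classical in
/-- The weight of the three bits of a gadget: the signed measure is negative on cycles. -/
def gadgetWeight (z : Fin 3 → Bool) : ℝ := if ∀ j, z j = true then -1 else 3

/-- The bits of `x` inside `S` and those of `y` outside. -/
def glue {ι : Type*} (S : ι → Bool) (x y : ι → Bool) (j : ι) : Bool := bif S j then x j else y j

/-- The weights are the row and column sums divided by the total sum 20. Constant `b` then gives
equality, so the negative block costs nothing beyond the value 20 forced by constant functions. -/
theorem weightedNormLE_gadget_of_card (X₁ Y₁ : Finset (Fin 3 → Bool))
    (h : X₁.card = 4 ∧ Y₁.card = 2 ∨ X₁.card = 2 ∧ Y₁.card = 4) :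
    WeightedNormLE (fun x y => if x ∈ X₁ ∧ y ∈ Y₁ then (-1 / 8 : ℝ) else 3 / 8) 20 := by
  classical
  have hX8 : Fintype.card (Fin 3 → Bool) = 8 := by simp
  have hY' : ((Y₁ᶜ).card : ℝ) = 8 - Y₁.card := by
    rw [Finset.card_compl, hX8, Nat.cast_sub (by omega)]; norm_num
  have hsplit : ∀ (T : Finset (Fin 3 → Bool)) (f : (Fin 3 → Bool) → ℝ),
      ∑ x, f x = ∑ x ∈ T, f x + ∑ x ∈ Tᶜ, f x := fun T f => (Finset.sum_add_sum_compl T f).symm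
  have hconst : ∀ (T : Finset (Fin 3 → Bool)) (p q : ℝ),
      ∑ x, (if x ∈ T then p else q) = T.card * p + (8 - T.card) * q := by
    intro T p q
    have : ((Tᶜ).card : ℝ) = 8 - T.card := by
      rw [Finset.card_compl, hX8, Nat.cast_sub (hX8 ▸ T.card_le_univ)]; norm_num
    rw [hsplit T, Finset.sum_congr rfl fun x hx => if_pos hx,
      Finset.sum_congr rfl fun x hx => if_neg (Finset.mem_compl.1 hx)]
    simp [this]
  set p : ℝ := (3 - Y₁.card / 2) / 20 with hp
  set q : ℝ := (3 - X₁.card / 2) / 20 with hq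
  have hp0 : 0 < p := by rcases h with ⟨h1, h2⟩ | ⟨h1, h2⟩ <;> rw [hp, h2] <;> norm_num
  have hq0 : 0 < q := by rcases h with ⟨h1, h2⟩ | ⟨h1, h2⟩ <;> rw [hq, h1] <;> norm_num
  refine ⟨fun x => if x ∈ X₁ then p else 3 / 20, fun y => if y ∈ Y₁ then q else 3 / 20,
    fun x => ?_, fun y => ?_, ?_, ?_, fun b => ?_⟩
  · dsimp only; split_ifs <;> positivity
  · dsimp only; split_ifs <;> positivity
  · rw [hconst]; rcases h with ⟨h1, h2⟩ | ⟨h1, h2⟩ <;> rw [hp, h1, h2] <;> norm_num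
  · rw [hconst]; rcases h with ⟨h1, h2⟩ | ⟨h1, h2⟩ <;> rw [hq, h1, h2] <;> norm_num
  · set c := ∑ y ∈ Y₁, b y with hc
    set δ := ∑ y ∈ Y₁ᶜ, b y with hδ
    have hin : ∀ x, (∑ y, (if x ∈ X₁ ∧ y ∈ Y₁ then (-1 / 8 : ℝ) else 3 / 8) * b y) ^ 2 /
        (if x ∈ X₁ then p else 3 / 20) =
        if x ∈ X₁ then (3 / 8 * δ - c / 8) ^ 2 / p else (3 / 8 * (c + δ)) ^ 2 / (3 / 20) := by
      intro x
      by_cases hx : x ∈ X₁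
      · simp only [hx, true_and, if_true]
        rw [hsplit Y₁, Finset.sum_congr rfl fun y hy => by rw [if_pos hy],
          Finset.sum_congr (s₁ := Y₁ᶜ) rfl fun y hy => by rw [if_neg (Finset.mem_compl.1 hy)],
          ← Finset.mul_sum, ← Finset.mul_sum]
        congr 2; ring
      · simp only [hx, false_and, if_false]
        rw [← Finset.mul_sum, hsplit Y₁]
    have hout : ∑ y, (if y ∈ Y₁ then q else 3 / 20) * b y ^ 2 =
        q * ∑ y ∈ Y₁, b y ^ 2 + 3 / 20 * ∑ y ∈ Y₁ᶜ, b y ^ 2 := by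
      rw [hsplit Y₁, Finset.sum_congr rfl fun y hy => by rw [if_pos hy],
        Finset.sum_congr (s₁ := Y₁ᶜ) rfl fun y hy => by rw [if_neg (Finset.mem_compl.1 hy)],
        ← Finset.mul_sum, ← Finset.mul_sum]
    have hcs1 : c ^ 2 ≤ Y₁.card * ∑ y ∈ Y₁, b y ^ 2 := sq_sum_le_card_mul_sum_sq
    have hcs2 : δ ^ 2 ≤ (8 - Y₁.card) * ∑ y ∈ Y₁ᶜ, b y ^ 2 := hY' ▸ sq_sum_le_card_mul_sum_sq
    rw [Finset.sum_congr rfl fun x _ => hin x, hconst, hout]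
    generalize ∑ y ∈ Y₁, b y ^ 2 = s at *
    generalize ∑ y ∈ Y₁ᶜ, b y ^ 2 = t at *
    -- In the equality case of constant `b`, δ = 3c if `Y₁` has two elements and δ = c if it has
    -- four.
    rcases h with ⟨h1, h2⟩ | ⟨h1, h2⟩ <;> rw [h2] at hcs1 hcs2 <;> rw [hp, hq, h1, h2] <;>
      norm_num at hcs1 hcs2 ⊢ <;> nlinarith [sq_nonneg (δ - 3 * c), sq_nonneg (3 * δ - c), sq_nonneg (δ - c)]

/-- If `S` splits the three bits, "all true" is one bit on one side and two on the other, so the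
negative entries form a 4 × 2 or 2 × 4 block. Otherwise the sum of absolute values, 7·3 + 1 = 22, is
used. Dividing by 8 corrects for each string being glued from 8 pairs. -/
theorem weightedNormLE_gadget (S : Fin 3 → Bool) :
    WeightedNormLE (fun x y => gadgetWeight (glue S x y) / 8)
      (if ∃ b, ∀ j, S j = b then 22 else 20) := by
  classical
  set X₁ := Finset.univ.filter fun x : Fin 3 → Bool => ∀ j, S j = true → x j = true with hX
  set Y₁ := Finset.univ.filter fun y : Fin 3 → Bool => ∀ j, S j = false → y j = true with hY
  have hK : (fun x y => gadgetWeight (glue S x y) / 8) =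
      fun x y => if x ∈ X₁ ∧ y ∈ Y₁ then (-1 / 8 : ℝ) else 3 / 8 := by
    funext x y
    have : (∀ j, glue S x y j = true) ↔ x ∈ X₁ ∧ y ∈ Y₁ := by
      simp only [hX, hY, Finset.mem_filter, Finset.mem_univ, true_and, ← forall_and]
      refine forall_congr' fun j => ?_
      cases hS : S j <;> simp [glue, hS]
    unfold gadgetWeight
    simp only [this]
    split_ifs <;> ring
  have hcard : (X₁.card, Y₁.card) = if ∀ j, S j = true then (1, 8) else
      if ∀ j, S j = false then (8, 1) else if (Finset.univ.filter fun j => S j = true).card = 1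
      then (4, 2) else (2, 4) := by
    rw [hX, hY]
    clear hK hX hY X₁ Y₁
    revert S
    decide
  rw [hK]
  split_ifs with h
  · have hprod : X₁.card * Y₁.card = 8 := by
      obtain ⟨b, hb⟩ := h
      rw [Prod.ext_iff] at hcard
      cases b
      · simp [hb] at hcard
        simp [hcard]
      · simp [hb] at hcard
        simp [hcard]
    have habs : ∀ x y, |if x ∈ X₁ ∧ y ∈ Y₁ then (-1 / 8 : ℝ) else 3 / 8| =
        3 / 8 - 1 / 4 * ((if x ∈ X₁ then 1 else 0) * (if y ∈ Y₁ then 1 else 0)) := by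
      intro x y
      by_cases hx : x ∈ X₁ <;> by_cases hy : y ∈ Y₁ <;> norm_num [hx, hy, abs_of_pos, abs_of_neg]
    refine weightedNormLE_sum_abs _ (by norm_num) ?_ fun x => ?_
    · simp only [habs]
      simp only [Finset.sum_sub_distrib, ← Finset.mul_sum, ← Finset.sum_mul]
      have h8 : (X₁.card : ℝ) * Y₁.card = 8 := by exact_mod_cast hprod
      simp [h8]
      norm_num
    · refine Finset.sum_pos (fun y _ => ?_) Finset.univ_nonempty
      split_ifs <;> norm_num
  · refine weightedNormLE_gadget_of_card _ _ ?_
    have h1 : ¬ ∀ j, S j = true := fun h1 => h ⟨_, h1⟩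
    have h2 : ¬ ∀ j, S j = false := fun h1 => h ⟨_, h1⟩
    rw [if_neg h1, if_neg h2] at hcard
    split_ifs at hcard <;> simp at hcard <;> simp [hcard]

/-- A function of the bits in `S` times a function of the remaining bits has small correlation with
the product of the gadget weights. -/
theorem abs_sum_prod_gadgetWeight_mul_le {m : ℕ} (S : Fin m → Fin 3 → Bool)
    (u v : (Fin m → Fin 3 → Bool) → ℝ) {U V : ℝ}
    (hu : ∀ x, |u x| ≤ U) (hv : ∀ y, |v y| ≤ V) (hU : 0 ≤ U) (hV : 0 ≤ V)
    (huS : ∀ x y : Fin m → Fin 3 → Bool, u (fun g => glue (S g) (x g) (y g)) = u x)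
    (hvS : ∀ x y : Fin m → Fin 3 → Bool, v (fun g => glue (S g) (x g) (y g)) = v y) :
    |∑ z : Fin m → Fin 3 → Bool, (∏ g, gadgetWeight (z g)) * (u z * v z)| ≤
      (∏ g, if ∃ b, ∀ j, S g j = b then (22 : ℝ) else 20) * (U * V) := by
  classical
  have h := (WeightedNormLE.pi fun g => weightedNormLE_gadget (S g)).abs_sum_le
    (Finset.prod_nonneg fun g _ => by split_ifs <;> norm_num) hu hv hU hV
  convert h using 2
  -- Exchanging the bits outside `S` is an involution on pairs that makes the glued string the first
  -- component.
  let e : ((Fin m → Fin 3 → Bool) × (Fin m → Fin 3 → Bool)) ≃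
      ((Fin m → Fin 3 → Bool) × (Fin m → Fin 3 → Bool)) :=
    Function.Involutive.toPerm
      (fun p => (fun g => glue (S g) (p.1 g) (p.2 g), fun g => glue (S g) (p.2 g) (p.1 g)))
      (fun p => by
        ext g j <;> cases hS : S g j <;> simp [glue, hS])
  have h1 := e.sum_comp fun p => (∏ g, gadgetWeight (p.1 g) / 8) * (u p.1 * v p.1)
  rw [Fintype.sum_prod_type, Fintype.sum_prod_type] at h1
  have h2 : ∀ x y, (e (x, y)).1 = fun g => glue (S g) (x g) (y g) := fun x y => rfl
  simp only [h2, huS, hvS] at h1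
  rw [h1]
  refine Finset.sum_congr rfl fun x _ => ?_
  simp [Finset.prod_div_distrib]
  field_simp

/-! ### Set-multilinear monomials and the rows of a product -/

section RowMonomials

variable {V : Type} {r : V}

/-- The exponent of `∏_{i ∈ A} x_{i, ν i}`. -/
def rowMonomial (A : Finset {v : V // v ≠ r}) (ν : {v : V // v ≠ r} → V) : V × V →₀ ℕ :=
  ∑ i ∈ A, Finsupp.single (i.1, ν i) 1

theorem rowMonomial_apply [DecidableEq V] (A : Finset {v : V // v ≠ r}) (ν : {v : V // v ≠ r} → V)
    (i : {v : V // v ≠ r}) (j : V) :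
    rowMonomial A ν (i.1, j) = if i ∈ A ∧ ν i = j then 1 else 0 := by
  rw [rowMonomial, Finsupp.finsetSum_apply]
  simp only [Finsupp.single_apply, Prod.mk.injEq, Subtype.val_inj]
  rw [Finset.sum_congr rfl (g := fun k => if k = i then (if ν i = j then 1 else 0) else 0)]
  · rw [Finset.sum_ite_eq']
    split_ifs <;> tauto
  · intro k _
    by_cases h : k = i
    · subst h; simp
    · simp [h]

theorem rowMonomial_apply_root [DecidableEq V] (A : Finset {v : V // v ≠ r})
    (ν : {v : V // v ≠ r} → V) (j : V) :
    rowMonomial A ν (r, j) = 0 := by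
  rw [rowMonomial, Finsupp.finsetSum_apply]
  refine Finset.sum_eq_zero fun k _ => ?_
  rw [Finsupp.single_apply, if_neg fun h => k.2 (Prod.ext_iff.1 h).1]

theorem ext_rows [DecidableEq V] {a b : V × V →₀ ℕ}
    (h : ∀ (i : {v : V // v ≠ r}) j, a (i.1, j) = b (i.1, j))
    (hr : ∀ j, a (r, j) = b (r, j)) : a = b := by
  ext ⟨i, j⟩
  by_cases hi : i = r
  · subst hi; exact hr j
  · exact h ⟨i, hi⟩ j

theorem rowMonomial_congr {A : Finset {v : V // v ≠ r}} {ν ν' : {v : V // v ≠ r} → V}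
    (h : ∀ i ∈ A, ν i = ν' i) : rowMonomial A ν = rowMonomial A ν' :=
  Finset.sum_congr rfl fun i hi => by rw [h i hi]

theorem rowMonomial_univ_injective [Fintype V] [DecidableEq V] :
    Function.Injective (rowMonomial (r := r) (Finset.univ : Finset {v : V // v ≠ r})) := by
  intro ν ν' h
  funext i
  have h1 := DFunLike.congr_fun h (i.1, ν' i)
  rw [rowMonomial_apply, rowMonomial_apply] at h1
  by_contra hne
  simp [hne] at h1

theorem rowMonomial_add_compl [Fintype V] [DecidableEq V] (A : Finset {v : V // v ≠ r})
    (ν : {v : V // v ≠ r} → V) :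
    rowMonomial A ν + rowMonomial Aᶜ ν = rowMonomial Finset.univ ν :=
  Finset.sum_add_sum_compl A _

theorem degree_rowMonomial (A : Finset {v : V // v ≠ r}) (ν : {v : V // v ≠ r} → V) :
    ((rowMonomial A ν).sum fun _ e => e) = A.card := by
  have : (rowMonomial A ν).degree = A.card := by
    rw [rowMonomial, map_sum]
    simp
  rw [← this]
  rfl

/-- The polynomial whose coefficients are `1` on all maps, plus `δ` on the spanning trees. -/
theorem fullSetMultilinear_add_eq [Fintype V] [DecidableEq V] (δ : ℝ)
    [DecidablePred (IsRootedSpanningTree (⊤ : SimpleGraph V) r)] :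
    fullSetMultilinear V r + C δ * spanningTreePoly (⊤ : SimpleGraph V) r =
      ∑ ν, monomial (rowMonomial Finset.univ ν)
        (1 + if IsRootedSpanningTree (⊤ : SimpleGraph V) r ν then δ else 0) := by
  have hmon : ∀ ν : {v : V // v ≠ r} → V, ∏ i : {v : V // v ≠ r}, (X (i.1, ν i) : MvPolynomial (V × V) ℝ) =
      monomial (rowMonomial Finset.univ ν) 1 := by
    intro ν
    rw [rowMonomial, monomial_sum_one]
    rfl
  unfold fullSetMultilinear spanningTreePoly
  rw [Finset.prod_univ_sum, Fintype.piFinset_univ]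
  simp only [hmon, map_add, Finset.sum_add_distrib, Finset.mul_sum, C_mul_monomial, mul_one]
  congr 1
  rw [Finset.sum_filter]
  refine Finset.sum_congr rfl fun ν _ => ?_
  split_ifs <;> simp

theorem coeff_sum_monomial_rowMonomial [Fintype V] [DecidableEq V] (c : ({v : V // v ≠ r} → V) → ℝ)
    (ν : {v : V // v ≠ r} → V) :
    coeff (rowMonomial Finset.univ ν) (∑ ν, monomial (rowMonomial Finset.univ ν) (c ν)) = c ν := by
  simp only [coeff_sum, coeff_monomial, rowMonomial_univ_injective.eq_iff]
  simp

theorem exists_eq_of_coeff_sum_monomial_ne_zero [Fintype V] [DecidableEq V]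
    (c : ({v : V // v ≠ r} → V) → ℝ) {m : V × V →₀ ℕ}
    (h : coeff m (∑ ν, monomial (rowMonomial Finset.univ ν) (c ν)) ≠ 0) :
    ∃ ν : {v : V // v ≠ r} → V, m = rowMonomial Finset.univ ν := by
  rw [coeff_sum] at h
  obtain ⟨ν, -, hν⟩ := Finset.exists_ne_zero_of_sum_ne_zero h
  rw [coeff_monomial] at hν
  exact ⟨ν, by by_contra hne; exact hν (if_neg (Ne.symm hne))⟩

theorem isHomogeneous_sum_monomial [Fintype V] [DecidableEq V] (c : ({v : V // v ≠ r} → V) → ℝ) :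
    (∑ ν, monomial (rowMonomial Finset.univ ν) (c ν)).IsHomogeneous
      (Fintype.card {v : V // v ≠ r}) := by
  refine IsHomogeneous.sum _ _ _ fun ν _ => isHomogeneous_monomial _ ?_
  rw [← Finset.card_univ, ← degree_rowMonomial Finset.univ ν]
  rfl

/-- Nonnegative coefficients cannot cancel; the row structure of the factors rests on this. -/
theorem coeff_add_mul_ne_zero {σ : Type*} {P Q : MvPolynomial σ NNReal} {p q : σ →₀ ℕ}
    (hp : coeff p P ≠ 0) (hq : coeff q Q ≠ 0) : coeff (p + q) (P * Q) ≠ 0 := by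
  classical
  rw [coeff_mul]
  refine ne_of_gt (lt_of_lt_of_le (pos_iff_ne_zero.2 (mul_ne_zero hp hq)) ?_)
  exact Finset.single_le_sum (f := fun x : (σ →₀ ℕ) × (σ →₀ ℕ) => coeff x.1 P * coeff x.2 Q)
    (fun _ _ => zero_le) (Finset.HasAntidiagonal.mem_antidiagonal.2 (rfl : (p, q).1 + (p, q).2 = p + q))

/-- The factors of a monotone set-multilinear product are set-multilinear in complementary rows. -/
theorem exists_rows_of_mul [Fintype V] [DecidableEq V] {P Q : MvPolynomial (V × V) NNReal}
    (h : ∀ m, coeff m (P * Q) ≠ 0 → ∃ ν : {v : V // v ≠ r} → V, m = rowMonomial Finset.univ ν)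
    (hP : P ≠ 0) (hQ : Q ≠ 0) :
    ∃ A : Finset {v : V // v ≠ r}, (∀ p, coeff p P ≠ 0 → ∃ ν, p = rowMonomial A ν) ∧
      ∀ q, coeff q Q ≠ 0 → ∃ ν, q = rowMonomial Aᶜ ν := by
  classical
  obtain ⟨p₀, hp₀⟩ := ne_zero_iff.1 hP
  obtain ⟨q₀, hq₀⟩ := ne_zero_iff.1 hQ
  -- The rows missed by one monomial q₀ of `Q`: as p + q₀ has exactly one entry in each row, every
  -- monomial p of `P` fills exactly these rows.
  set A : Finset {v : V // v ≠ r} := Finset.univ.filter fun i => ∀ j, q₀ (i.1, j) = 0 with hA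
  have hPA : ∀ p, coeff p P ≠ 0 → ∃ ν, p = rowMonomial A ν := by
    intro p hp
    obtain ⟨ν, hν⟩ := h _ (coeff_add_mul_ne_zero hp hq₀)
    have hν' : ∀ a, p a + q₀ a = rowMonomial Finset.univ ν a := fun a => DFunLike.congr_fun hν a
    refine ⟨ν, ext_rows (r := r) (fun i j => ?_) fun j => ?_⟩
    · have h1 := hν' (i.1, j)
      rw [rowMonomial_apply] at h1 ⊢
      by_cases hi : i ∈ A
      · have := (Finset.mem_filter.1 hi).2 j
        simpa [hi, this] using h1
      · have h2 : ∃ j, q₀ (i.1, j) ≠ 0 := by simpa [hA] using hi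
        obtain ⟨j', hj'⟩ := h2
        have h3 := hν' (i.1, j')
        rw [rowMonomial_apply] at h3
        simp only [hi, false_and, if_false]
        by_cases h4 : ν i = j'
        · subst h4
          by_cases h5 : ν i = j
          · subst h5
            simp at h3
            omega
          · simp [h5] at h1
            omega
        · simp [h4] at h3
          omega
    · have h1 := hν' (r, j)
      rw [rowMonomial_apply_root] at h1 ⊢
      omega
  refine ⟨A, hPA, fun q hq => ?_⟩
  obtain ⟨ν₀, rfl⟩ := hPA p₀ hp₀
  obtain ⟨ν, hν⟩ := h _ (coeff_add_mul_ne_zero hp₀ hq)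
  have hν' : ∀ a, rowMonomial A ν₀ a + q a = rowMonomial Finset.univ ν a :=
    fun a => DFunLike.congr_fun hν a
  refine ⟨ν, ext_rows (r := r) (fun i j => ?_) fun j => ?_⟩
  · have h1 := hν' (i.1, j)
    have h2 := hν' (i.1, ν₀ i)
    rw [rowMonomial_apply, rowMonomial_apply] at h1 h2
    rw [rowMonomial_apply]
    by_cases hi : i ∈ A
    · by_cases h3 : ν i = ν₀ i
      · simp [hi, h3] at h1 ⊢
        omega
      · simp [hi, h3] at h2
    · simpa [hi] using h1
  · have h1 := hν' (r, j)
    rw [rowMonomial_apply_root, rowMonomial_apply_root] at h1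
    rw [rowMonomial_apply_root]
    omega

theorem totalDegree_eq_card_of_rows [Fintype V] [DecidableEq V] {P : MvPolynomial (V × V) NNReal}
    (hP : P ≠ 0)
    {A : Finset {v : V // v ≠ r}} (h : ∀ p, coeff p P ≠ 0 → ∃ ν, p = rowMonomial A ν) :
    P.totalDegree = A.card := by
  refine le_antisymm (Finset.sup_le fun p hp => ?_) ?_
  · obtain ⟨ν, rfl⟩ := h p (mem_support_iff.1 hp)
    exact (degree_rowMonomial A ν).le
  · obtain ⟨p, hp⟩ := ne_zero_iff.1 hP
    obtain ⟨ν, rfl⟩ := h p hp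
    exact degree_rowMonomial A ν ▸ le_totalDegree (mem_support_iff.2 hp)

/-- The rows decide how a monomial splits between the factors, so the convolution has a single term.
-/
theorem coeff_mul_of_rows [Fintype V] [DecidableEq V] {P Q : MvPolynomial (V × V) NNReal}
    {A : Finset {v : V // v ≠ r}}
    (hP : ∀ p, coeff p P ≠ 0 → ∃ ν, p = rowMonomial A ν)
    (hQ : ∀ q, coeff q Q ≠ 0 → ∃ ν, q = rowMonomial Aᶜ ν) (ν : {v : V // v ≠ r} → V) :
    coeff (rowMonomial Finset.univ ν) (P * Q) =
      coeff (rowMonomial A ν) P * coeff (rowMonomial Aᶜ ν) Q := by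
  classical
  rw [coeff_mul]
  refine Finset.sum_eq_single_of_mem (rowMonomial A ν, rowMonomial Aᶜ ν)
    (Finset.HasAntidiagonal.mem_antidiagonal.2 (rowMonomial_add_compl A ν)) ?_
  rintro ⟨p, q⟩ hpq hne
  by_contra h0
  obtain ⟨ν₁, rfl⟩ := hP p (left_ne_zero_of_mul h0)
  obtain ⟨ν₂, rfl⟩ := hQ q (right_ne_zero_of_mul h0)
  have hsum : ∀ a, rowMonomial A ν₁ a + rowMonomial Aᶜ ν₂ a = rowMonomial Finset.univ ν a :=
    fun a => DFunLike.congr_fun (Finset.HasAntidiagonal.mem_antidiagonal.1 hpq) a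
  refine hne (Prod.ext (rowMonomial_congr fun i hi => ?_) (rowMonomial_congr fun i hi => ?_))
  · have h1 := hsum (i.1, ν₁ i)
    simp only [rowMonomial_apply] at h1
    by_contra hh
    simp [hi, Ne.symm hh] at h1
  · have h1 := hsum (i.1, ν₂ i)
    simp only [rowMonomial_apply] at h1
    by_contra hh
    simp [Finset.mem_compl.1 hi, Ne.symm hh] at h1

end RowMonomials

/-! ### Correlation of a product with the signed measure on gadget maps -/

section Gadgets

variable {V : Type} {r : V} {m : ℕ}

/-- The map of the vertices in which the vertex at place `j` of gadget `g` is sent to the next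
vertex of the gadget if the bit `x g j` is set, and every other vertex is sent to the root. -/
def gadgetMap (w : Fin m × Fin 3 → {v : V // v ≠ r}) (x : Fin m → Fin 3 → Bool) :
    {v : V // v ≠ r} → V :=
  Function.extend w (fun p => bif x p.1 p.2 then (w (p.1, p.2 + 1)).1 else r) (fun _ => r)

theorem gadgetMap_apply {w : Fin m × Fin 3 → {v : V // v ≠ r}} (hw : Function.Injective w)
    (x : Fin m → Fin 3 → Bool) (g : Fin m) (j : Fin 3) :
    gadgetMap w x (w (g, j)) = bif x g j then (w (g, j + 1)).1 else r :=
  hw.extend_apply _ _ (g, j)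

theorem gadgetMap_of_notMem {w : Fin m × Fin 3 → {v : V // v ≠ r}}
    (x : Fin m → Fin 3 → Bool) {i : {v : V // v ≠ r}} (hi : ¬ ∃ p, w p = i) :
    gadgetMap w x i = r :=
  Function.extend_apply' _ _ i hi

theorem gadgetMap_congr {w : Fin m × Fin 3 → {v : V // v ≠ r}} (hw : Function.Injective w)
    {x y : Fin m → Fin 3 → Bool} {i : {v : V // v ≠ r}}
    (h : ∀ g j, w (g, j) = i → x g j = y g j) : gadgetMap w x i = gadgetMap w y i := by
  by_cases hi : ∃ p, w p = i
  · obtain ⟨⟨g, j⟩, rfl⟩ := hi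
    rw [gadgetMap_apply hw, gadgetMap_apply hw, h g j rfl]
  · rw [gadgetMap_of_notMem _ hi, gadgetMap_of_notMem _ hi]

open Classical in
/-- The norm of a gadget on the triple `t` with respect to the partition into `A` and its
complement: it is smaller if the triple meets both parts. -/
def crossingNorm {I : Type*} (A : Finset I) (t : Fin 3 → I) : ℝ :=
  if (∀ j, t j ∈ A) ∨ (∀ j, t j ∉ A) then 22 else 20

theorem crossingNorm_nonneg {I : Type*} (A : Finset I) (t : Fin 3 → I) : 0 ≤ crossingNorm A t := by
  unfold crossingNorm; split_ifs <;> norm_num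

theorem abs_sum_gadget_coeff_mul_le [Fintype V] [DecidableEq V] {P Q : MvPolynomial (V × V) NNReal}
    {A : Finset {v : V // v ≠ r}}
    (hP : ∀ p, coeff p P ≠ 0 → ∃ ν, p = rowMonomial A ν)
    (hQ : ∀ q, coeff q Q ≠ 0 → ∃ ν, q = rowMonomial Aᶜ ν) {B : ℝ}
    (hB : ∀ ν : {v : V // v ≠ r} → V, ((coeff (rowMonomial Finset.univ ν) (P * Q) : NNReal) : ℝ) ≤ B)
    {w : Fin m × Fin 3 → {v : V // v ≠ r}} (hw : Function.Injective w) :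
    |∑ x : Fin m → Fin 3 → Bool, (∏ g, gadgetWeight (x g)) *
      ((coeff (rowMonomial Finset.univ (gadgetMap w x)) (P * Q) : NNReal) : ℝ)| ≤
      (∏ g, crossingNorm A fun j => w (g, j)) * B := by
  classical
  have : Nonempty V := ⟨r⟩
  obtain ⟨ν₁, h₁⟩ := Finite.exists_max fun ν : {v : V // v ≠ r} → V => coeff (rowMonomial A ν) P
  obtain ⟨ν₂, h₂⟩ := Finite.exists_max fun ν : {v : V // v ≠ r} → V => coeff (rowMonomial Aᶜ ν) Q
  -- A single map agrees with ν₁ on `A` and with ν₂ elsewhere, so the product of the two maxima is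
  -- itself a coefficient of `P * Q`.
  have hUV : ((coeff (rowMonomial A ν₁) P : NNReal) : ℝ) * ((coeff (rowMonomial Aᶜ ν₂) Q : NNReal) : ℝ) ≤ B := by
    have h := hB fun i => if i ∈ A then ν₁ i else ν₂ i
    rw [coeff_mul_of_rows hP hQ, rowMonomial_congr (A := A) (ν' := ν₁) fun i hi => if_pos hi,
      rowMonomial_congr (A := Aᶜ) (ν' := ν₂) fun i hi => if_neg (Finset.mem_compl.1 hi)] at h
    exact_mod_cast h
  simp only [coeff_mul_of_rows hP hQ, NNReal.coe_mul]
  set S : Fin m → Fin 3 → Bool := fun g j => decide (w (g, j) ∈ A) with hS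
  have h := abs_sum_prod_gadgetWeight_mul_le S
    (fun x => ((coeff (rowMonomial A (gadgetMap w x)) P : NNReal) : ℝ))
    (fun x => ((coeff (rowMonomial Aᶜ (gadgetMap w x)) Q : NNReal) : ℝ))
    (U := ((coeff (rowMonomial A ν₁) P : NNReal) : ℝ)) (V := ((coeff (rowMonomial Aᶜ ν₂) Q : NNReal) : ℝ))
    (fun x => by rw [abs_of_nonneg (NNReal.coe_nonneg _)]; exact_mod_cast h₁ _)
    (fun x => by rw [abs_of_nonneg (NNReal.coe_nonneg _)]; exact_mod_cast h₂ _)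
    (NNReal.coe_nonneg _) (NNReal.coe_nonneg _)
    (fun x y => by
      rw [rowMonomial_congr fun i hi => gadgetMap_congr hw (y := x) fun g j hg => ?_]
      subst hg
      simp [glue, hS, hi])
    (fun x y => by
      rw [rowMonomial_congr fun i hi => gadgetMap_congr hw (y := y) fun g j hg => ?_]
      subst hg
      simp [glue, hS, Finset.mem_compl.1 hi])
  have hnorm : ∀ g, (if ∃ b, ∀ j, S g j = b then (22 : ℝ) else 20) =
      crossingNorm A fun j => w (g, j) := by
    intro g
    have hiff : (∃ b, ∀ j, S g j = b) ↔ (∀ j, w (g, j) ∈ A) ∨ ∀ j, w (g, j) ∉ A := by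
      simp [hS, or_comm]
    unfold crossingNorm
    split_ifs <;> tauto
  simp only [hnorm] at h
  exact h.trans (mul_le_mul_of_nonneg_left hUV
    (Finset.prod_nonneg fun g _ => crossingNorm_nonneg A _))

theorem sum_crossingNorm {I : Type*} [Fintype I] [DecidableEq I] (A : Finset I) :
    ∑ t : Fin 3 → I, crossingNorm A t =
      20 * (Fintype.card I : ℝ) ^ 3 + 2 * ((A.card : ℝ) ^ 3 + ((Aᶜ).card : ℝ) ^ 3) := by
  classical
  have h1 : ∀ t : Fin 3 → I, crossingNorm A t =
      20 + 2 * ((if t ∈ Fintype.piFinset fun _ => A then 1 else 0) +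
        (if t ∈ Fintype.piFinset fun _ => Aᶜ then 1 else 0)) := by
    intro t
    unfold crossingNorm
    simp only [Fintype.mem_piFinset, Finset.mem_compl]
    by_cases h2 : ∀ j, t j ∈ A <;> by_cases h3 : ∀ j, t j ∉ A
    · exact absurd (h2 0) (h3 0)
    · rw [if_pos (Or.inl h2), if_pos h2, if_neg h3]; norm_num
    · rw [if_pos (Or.inr h3), if_neg h2, if_pos h3]; norm_num
    · rw [if_neg (not_or.2 ⟨h2, h3⟩), if_neg h2, if_neg h3]; norm_num
  simp only [h1, Finset.sum_add_distrib, ← Finset.mul_sum, Finset.sum_ite_mem, Finset.univ_inter]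
  simp [Fintype.card_piFinset]
  ring

/-- If both parts contain at least a third of the points, the average norm of a random triple is at
most `62 / 3`. -/
theorem sum_prod_crossingNorm_le {I : Type*} [Fintype I] [DecidableEq I] (A : Finset I) (m : ℕ)
    (h₁ : Fintype.card I ≤ 3 * A.card) (h₂ : 3 * A.card ≤ 2 * Fintype.card I) :
    ∑ w : Fin m × Fin 3 → I, ∏ g, crossingNorm A (fun j => w (g, j)) ≤
      (62 / 3 * (Fintype.card I : ℝ) ^ 3) ^ m := by
  have h := (Equiv.curry (Fin m) (Fin 3) I).sum_comp fun t => ∏ g, crossingNorm A (t g)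
  have h' : ∑ w : Fin m × Fin 3 → I, ∏ g, crossingNorm A (fun j => w (g, j)) =
      ∑ t : Fin m → Fin 3 → I, ∏ g, crossingNorm A (t g) := h
  rw [h', ← Fintype.piFinset_univ, ← Finset.prod_univ_sum (fun _ => Finset.univ)
    fun (_ : Fin m) t => crossingNorm A t, Finset.prod_const, Finset.card_univ, Fintype.card_fin]
  refine pow_le_pow_left₀ (Finset.sum_nonneg fun t _ => crossingNorm_nonneg A t) ?_ m
  rw [sum_crossingNorm, Finset.card_compl, Nat.cast_sub A.card_le_univ]
  have h3 : (Fintype.card I : ℝ) ≤ 3 * A.card := by exact_mod_cast h₁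
  have h4 : 3 * (A.card : ℝ) ≤ 2 * Fintype.card I := by exact_mod_cast h₂
  have h5 : (0 : ℝ) ≤ Fintype.card I := Nat.cast_nonneg _
  generalize (Fintype.card I : ℝ) = N at *
  generalize (A.card : ℝ) = a at *
  -- With b = N - a, a³ + b³ = N³ - 3Nab, and (3a - N)(2N - 3a) ≥ 0 says ab ≥ 2N²/9; thus a³ + b³ ≤
  -- N³/3.
  nlinarith [mul_nonneg h5 (mul_nonneg (sub_nonneg.2 h3) (sub_nonneg.2 h4))]

end Gadgets

/-! ### Gadget maps that are trees, and the measure of F and ST -/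

section Trees

variable {V : Type} {r : V} {m : ℕ}

theorem extendByRoot_root [DecidableEq V] (ν : {v : V // v ≠ r} → V) : extendByRoot r ν r = r :=
  dif_pos rfl

theorem extendByRoot_coe [DecidableEq V] (ν : {v : V // v ≠ r} → V) (i : {v : V // v ≠ r}) :
    extendByRoot r ν i.1 = ν i :=
  dif_neg i.2

/-- A gadget map is a spanning tree if and only if no gadget is a cycle. -/
theorem isRootedSpanningTree_gadgetMap_iff [DecidableEq V] {w : Fin m × Fin 3 → {v : V // v ≠ r}}
    (hw : Function.Injective w) (x : Fin m → Fin 3 → Bool) :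
    IsRootedSpanningTree (⊤ : SimpleGraph V) r (gadgetMap w x) ↔ ∀ g, ¬ ∀ j, x g j = true := by
  set f := extendByRoot r (gadgetMap w x) with hf
  have hfw : ∀ g j, f (w (g, j)).1 = bif x g j then (w (g, j + 1)).1 else r := fun g j => by
    rw [hf, extendByRoot_coe, gadgetMap_apply hw]
  have hfr : f r = r := extendByRoot_root _
  constructor
  · rintro ⟨-, h⟩ g hg
    obtain ⟨k, hk⟩ := h (w (g, 0)).1
    have h1 : ∀ k : ℕ, ∀ j, ∃ j', f^[k] (w (g, j)).1 = (w (g, j')).1 := by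
      intro k
      induction k with
      | zero => exact fun j => ⟨j, rfl⟩
      | succ k ih =>
        intro j
        obtain ⟨j', hj'⟩ := ih (j + 1)
        refine ⟨j', ?_⟩
        rw [Function.iterate_succ_apply, hfw, hg, cond_true, hj']
    obtain ⟨j', hj'⟩ := h1 k 0
    exact (w (g, j')).2 (hj'.symm.trans hk)
  · intro h
    -- A cleared bit sends its vertex to the root, and three steps around a triple must meet one.
    refine ⟨fun i => ?_, fun v => ⟨3, ?_⟩⟩
    · rw [SimpleGraph.top_adj]
      by_cases hi : ∃ p, w p = i
      · obtain ⟨⟨g, j⟩, rfl⟩ := hi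
        rw [gadgetMap_apply hw]
        cases x g j
        · exact (w (g, j)).2
        · intro h1
          have h2 := (Prod.ext_iff.1 (hw (Subtype.ext h1))).2
          exact absurd h2 (show j ≠ j + 1 by clear h1 h2; generalize j = k; revert k; decide)
      · rw [gadgetMap_of_notMem _ hi]
        exact i.2
    · show f (f (f v)) = r
      by_cases hv : v = r
      · rw [hv, hfr, hfr, hfr]
      · by_cases hi : ∃ p, w p = ⟨v, hv⟩
        · obtain ⟨⟨g, j⟩, hp⟩ := hi
          have hv' : v = (w (g, j)).1 := by rw [hp]
          rw [hv']
          have hx : x g j = false ∨ x g (j + 1) = false ∨ x g (j + 1 + 1) = false := by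
            by_contra hc
            simp only [not_or, Bool.not_eq_false] at hc
            refine h g fun j' => ?_
            have hj : j' = j ∨ j' = j + 1 ∨ j' = j + 1 + 1 := by
              clear hc hp hv' h
              revert j j'
              decide
            rcases hj with rfl | rfl | rfl
            exacts [hc.1, hc.2.1, hc.2.2]
          have hfalse : ∀ j, x g j = false → f (w (g, j)).1 = r := fun j hj => by
            rw [hfw, hj, cond_false]
          have hstep : ∀ j, f (w (g, j)).1 = r ∨ f (w (g, j)).1 = (w (g, j + 1)).1 := fun j => by
            rw [hfw]; cases x g j <;> simp
          rcases hstep j with h1 | h1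
          · rw [h1, hfr, hfr]
          · rw [h1]
            rcases hstep (j + 1) with h2 | h2
            · rw [h2, hfr]
            · rw [h2]
              rcases hx with hx | hx | hx
              · exact absurd (h1.symm.trans (hfalse _ hx)) (w (g, j + 1)).2
              · exact absurd (h2.symm.trans (hfalse _ hx)) (w (g, j + 1 + 1)).2
              · exact hfalse _ hx
        · have h1 : f v = r := by
            rw [hf, show v = (⟨v, hv⟩ : {v : V // v ≠ r}).1 from rfl, extendByRoot_coe,
              gadgetMap_of_notMem _ hi]
          rw [h1, hfr, hfr]

theorem card_filter_all_true :
    (Finset.univ.filter fun y : Fin 3 → Bool => ∀ j, y j = true).card = 1 := by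
  decide

theorem sum_prod_gadgetWeight :
    ∑ x : Fin m → Fin 3 → Bool, ∏ g, gadgetWeight (x g) = 20 ^ m := by
  classical
  rw [← Fintype.piFinset_univ, ← Finset.prod_univ_sum (fun _ => Finset.univ)
    fun (_ : Fin m) y => gadgetWeight y, Finset.prod_const, Finset.card_univ, Fintype.card_fin]
  congr 1
  have h : ∀ y, gadgetWeight y = 3 - 4 * if ∀ j, y j = true then 1 else 0 := fun y => by
    unfold gadgetWeight; split_ifs <;> norm_num
  simp only [h, Finset.sum_sub_distrib, ← Finset.mul_sum, Finset.sum_boole]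
  rw [card_filter_all_true]
  norm_num

open Classical in
-- The tree condition deletes the negative term of each gadget, leaving 7·3 = 21.
theorem sum_prod_gadgetWeight_tree [DecidableEq V] {w : Fin m × Fin 3 → {v : V // v ≠ r}}
    (hw : Function.Injective w) :
    ∑ x : Fin m → Fin 3 → Bool, (∏ g, gadgetWeight (x g)) *
      (if IsRootedSpanningTree (⊤ : SimpleGraph V) r (gadgetMap w x) then 1 else 0) = 21 ^ m := by
  have h1 : ∀ x : Fin m → Fin 3 → Bool, (∏ g, gadgetWeight (x g)) *
      (if IsRootedSpanningTree (⊤ : SimpleGraph V) r (gadgetMap w x) then 1 else 0) =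
      ∏ g, (3 - 3 * if ∀ j, x g j = true then (1 : ℝ) else 0) := by
    intro x
    rw [isRootedSpanningTree_gadgetMap_iff hw]
    split_ifs with h
    · rw [mul_one]
      refine Finset.prod_congr rfl fun g _ => ?_
      rw [gadgetWeight, if_neg (h g), if_neg (h g)]
      norm_num
    · obtain ⟨g, hg⟩ := not_forall.1 h
      rw [mul_zero, Finset.prod_eq_zero (Finset.mem_univ g)]
      rw [if_pos (not_not.1 hg)]
      norm_num
  simp only [h1]
  rw [← Fintype.piFinset_univ, ← Finset.prod_univ_sum (fun _ => Finset.univ)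
    fun (_ : Fin m) (y : Fin 3 → Bool) => 3 - 3 * if ∀ j, y j = true then (1 : ℝ) else 0,
    Finset.prod_const, Finset.card_univ, Fintype.card_fin]
  congr 1
  simp only [Finset.sum_sub_distrib, ← Finset.mul_sum, Finset.sum_boole]
  have := card_filter_all_true
  rw [Finset.filter_congr_decidable] at this
  rw [this]
  norm_num

end Trees

/-! ### Averaging over disjoint triples -/

/-- The injective choices of `m` triples in `I`. -/
def disjointTriples (m : ℕ) (I : Type*) [Fintype I] : Finset (Fin m × Fin 3 → I) :=
  @Finset.filter _ (fun w => Function.Injective w) (Classical.decPred _) Finset.univ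

theorem injective_of_mem_disjointTriples {m : ℕ} {I : Type*} [Fintype I] {w : Fin m × Fin 3 → I}
    (hw : w ∈ disjointTriples m I) : Function.Injective w := by
  simpa [disjointTriples] using hw

section Bounds

variable {V : Type} [Fintype V] [DecidableEq V] {r : V}

/-- The correlation with the signed measure, summed over all choices of disjoint triples, is
computed in two ways: exactly for the polynomial, and bounded product by product for its
decomposition. -/
theorem abs_mul_card_injective_le (C : MonotoneCircuit (V × V)) {δ : ℝ}
    (hC : C.Computes (fullSetMultilinear V r
      + MvPolynomial.C δ * spanningTreePoly (⊤ : SimpleGraph V) r))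
    (hN : 3 < Fintype.card {v : V // v ≠ r}) (m : ℕ) :
    |δ| * ((disjointTriples m {v : V // v ≠ r}).card * 21 ^ m) ≤
      (C.size * (1 + |δ|) + 1) * (62 / 3 * (Fintype.card {v : V // v ≠ r} : ℝ) ^ 3) ^ m := by
  classical
  set c : ({v : V // v ≠ r} → V) → ℝ := fun ν =>
    1 + if IsRootedSpanningTree (⊤ : SimpleGraph V) r ν then δ else 0 with hc
  have hf := fullSetMultilinear_add_eq (V := V) (r := r) δ
  rw [hf] at hC
  obtain ⟨P, Q, hPQ, hdeg⟩ := C.exists_decomposition hC hN (isHomogeneous_sum_monomial c)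
  set N := Fintype.card {v : V // v ≠ r} with hNdef
  set W := disjointTriples m {v : V // v ≠ r} with hW
  have hcoeff : ∀ ν : {v : V // v ≠ r} → V,
      ∑ g, ((coeff (rowMonomial Finset.univ ν) (P g * Q g) : NNReal) : ℝ) = c ν := by
    intro ν
    rw [← coeff_sum_monomial_rowMonomial c ν, ← hPQ, coeff_map, coeff_sum, map_sum]
    rfl
  have hcB : ∀ ν, c ν ≤ 1 + |δ| := by
    intro ν
    rw [hc]
    dsimp only
    split_ifs
    · linarith [le_abs_self δ]
    · linarith [abs_nonneg δ]
  have hrect : ∀ g, |∑ w ∈ W, ∑ x : Fin m → Fin 3 → Bool, (∏ h, gadgetWeight (x h)) *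
      ((coeff (rowMonomial Finset.univ (gadgetMap w x)) (P g * Q g) : NNReal) : ℝ)| ≤
      (1 + |δ|) * (62 / 3 * (N : ℝ) ^ 3) ^ m := by
    intro g
    have hnn : 0 ≤ (1 + |δ|) * (62 / 3 * (N : ℝ) ^ 3) ^ m := by positivity
    rcases eq_or_ne (P g) 0 with hP0 | hP0
    · simpa [hP0] using hnn
    rcases eq_or_ne (Q g) 0 with hQ0 | hQ0
    · simpa [hQ0] using hnn
    have hsupp : ∀ a, coeff a (P g * Q g) ≠ 0 →
        ∃ ν : {v : V // v ≠ r} → V, a = rowMonomial Finset.univ ν := by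
      intro a ha
      refine exists_eq_of_coeff_sum_monomial_ne_zero c ?_
      rw [← hPQ, coeff_map, coeff_sum]
      refine fun h0 => ha ?_
      have h1 := NNReal.coe_eq_zero.1 h0
      exact (Finset.sum_eq_zero_iff.1 h1) g (Finset.mem_univ g)
    obtain ⟨A, hPA, hQA⟩ := exists_rows_of_mul hsupp hP0 hQ0
    obtain ⟨hd1, hd2⟩ := (hdeg g).resolve_left hQ0
    rw [totalDegree_eq_card_of_rows hP0 hPA] at hd1 hd2
    have hB : ∀ ν : {v : V // v ≠ r} → V,
        ((coeff (rowMonomial Finset.univ ν) (P g * Q g) : NNReal) : ℝ) ≤ 1 + |δ| := by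
      intro ν
      refine le_trans ?_ ((hcoeff ν).le.trans (hcB ν))
      exact Finset.single_le_sum
        (f := fun g => ((coeff (rowMonomial Finset.univ ν) (P g * Q g) : NNReal) : ℝ))
        (fun _ _ => NNReal.coe_nonneg _) (Finset.mem_univ g)
    have hφ : ∀ w : Fin m × Fin 3 → {v : V // v ≠ r},
        0 ≤ (∏ g, crossingNorm A fun j => w (g, j)) * (1 + |δ|) := fun w =>
      mul_nonneg (Finset.prod_nonneg fun _ _ => crossingNorm_nonneg _ _) (by positivity)
    calc _ ≤ ∑ w ∈ W, |∑ x : Fin m → Fin 3 → Bool, (∏ h, gadgetWeight (x h)) *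
          ((coeff (rowMonomial Finset.univ (gadgetMap w x)) (P g * Q g) : NNReal) : ℝ)| :=
          Finset.abs_sum_le_sum_abs _ _
      _ ≤ ∑ w ∈ W, (∏ g, crossingNorm A fun j => w (g, j)) * (1 + |δ|) :=
          Finset.sum_le_sum fun w hw =>
            abs_sum_gadget_coeff_mul_le hPA hQA hB (injective_of_mem_disjointTriples hw)
      -- The bounds are nonnegative, so injectivity may be dropped; the triples become independent
      -- and the sum factors.
      _ ≤ ∑ w : Fin m × Fin 3 → {v : V // v ≠ r},
          (∏ g, crossingNorm A fun j => w (g, j)) * (1 + |δ|) :=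
          Finset.sum_le_univ_sum_of_nonneg hφ
      _ ≤ (1 + |δ|) * (62 / 3 * (N : ℝ) ^ 3) ^ m := by
          rw [← Finset.sum_mul, mul_comm]
          exact mul_le_mul_of_nonneg_left (sum_prod_crossingNorm_le A m hd1 hd2.le) (by positivity)
  have htotal : ∑ g, ∑ w ∈ W, ∑ x : Fin m → Fin 3 → Bool, (∏ h, gadgetWeight (x h)) *
      ((coeff (rowMonomial Finset.univ (gadgetMap w x)) (P g * Q g) : NNReal) : ℝ) =
      W.card * 20 ^ m + δ * (W.card * 21 ^ m) := by
    rw [Finset.sum_comm]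
    have hinner : ∀ w ∈ W, ∑ g, ∑ x : Fin m → Fin 3 → Bool, (∏ h, gadgetWeight (x h)) *
        ((coeff (rowMonomial Finset.univ (gadgetMap w x)) (P g * Q g) : NNReal) : ℝ) =
        20 ^ m + δ * 21 ^ m := by
      intro w hw
      rw [Finset.sum_comm]
      simp only [← Finset.mul_sum, hcoeff]
      rw [← sum_prod_gadgetWeight, ← sum_prod_gadgetWeight_tree (injective_of_mem_disjointTriples hw),
        Finset.mul_sum, ← Finset.sum_add_distrib]
      refine Finset.sum_congr rfl fun x _ => ?_
      rw [hc]
      dsimp only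
      split_ifs <;> ring
    rw [Finset.sum_congr rfl hinner, Finset.sum_const, nsmul_eq_mul]
    ring
  have habs : |(W.card : ℝ) * 20 ^ m + δ * (W.card * 21 ^ m)| ≤
      C.size * ((1 + |δ|) * (62 / 3 * (N : ℝ) ^ 3) ^ m) := by
    rw [← htotal]
    refine (Finset.abs_sum_le_sum_abs _ _).trans ((Finset.sum_le_sum fun g _ => hrect g).trans ?_)
    rw [Finset.sum_const, Finset.card_univ, Fintype.card_fin, nsmul_eq_mul]
  -- The contribution of F itself is absorbed, since 20 ≤ 62/3; it is the final `+ 1` in the bound.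
  have hWcard : (W.card : ℝ) * 20 ^ m ≤ (62 / 3 * (N : ℝ) ^ 3) ^ m := by
    have h1 : W.card ≤ N ^ (m * 3) := by
      refine (Finset.card_le_univ W).trans ?_
      rw [Fintype.card_fun, Fintype.card_prod, Fintype.card_fin, Fintype.card_fin]
    have h2 : (W.card : ℝ) ≤ (N : ℝ) ^ (m * 3) := by exact_mod_cast h1
    rw [mul_pow, ← pow_mul, mul_comm 3 m, mul_comm]
    gcongr
    norm_num
  have h1 : |δ| * ((W.card : ℝ) * 21 ^ m) = |δ * (W.card * 21 ^ m)| := by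
    rw [abs_mul, abs_of_nonneg (a := (W.card : ℝ) * 21 ^ m) (by positivity)]
  have h2 : |δ * ((W.card : ℝ) * 21 ^ m)| ≤ |(W.card : ℝ) * 20 ^ m + δ * (W.card * 21 ^ m)| +
      (W.card : ℝ) * 20 ^ m := by
    have h3 := abs_sub ((W.card : ℝ) * 20 ^ m + δ * (W.card * 21 ^ m)) ((W.card : ℝ) * 20 ^ m)
    rw [add_sub_cancel_left, abs_of_nonneg (a := (W.card : ℝ) * 20 ^ m) (by positivity)] at h3
    exact h3
  rw [h1]
  linarith

theorem pow_sub_le_card_injective {I : Type*} [Fintype I] (m : ℕ) :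
    (Fintype.card I - 3 * m) ^ (3 * m) ≤ (disjointTriples m I).card := by
  classical
  have h : (disjointTriples m I).card = (Fintype.card I).descFactorial (m * 3) := by
    rw [disjointTriples, ← Fintype.card_subtype,
      Fintype.card_congr (Equiv.subtypeInjectiveEquivEmbedding (Fin m × Fin 3) I),
      Fintype.card_embedding_eq, Fintype.card_prod, Fintype.card_fin, Fintype.card_fin]
  rw [h, mul_comm 3 m]
  exact (Nat.pow_le_pow_left (by omega) _).trans (Nat.pow_sub_le_descFactorial _ _)

/-- The size bound in the form `|δ| ρ ^ m ≤ s (1 + |δ|) + 1`. -/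
theorem abs_mul_pow_le_size (C : MonotoneCircuit (V × V)) {δ : ℝ}
    (hC : C.Computes (fullSetMultilinear V r
      + MvPolynomial.C δ * spanningTreePoly (⊤ : SimpleGraph V) r))
    (hN : 3 < Fintype.card {v : V // v ≠ r}) {m : ℕ}
    (hm : 1200 * m ≤ Fintype.card {v : V // v ≠ r}) :
    |δ| * (1 + 1 / 126) ^ m ≤ C.size * (1 + |δ|) + 1 := by
  classical
  have h1 := abs_mul_card_injective_le C hC hN m
  have h2 := pow_sub_le_card_injective (I := {v : V // v ≠ r}) m
  generalize (disjointTriples m {v : V // v ≠ r}).card = W at h1 h2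
  generalize Fintype.card {v : V // v ≠ r} = N at h1 h2 hN hm
  have hN0 : (0 : ℝ) < N := by exact_mod_cast (by omega : 0 < N)
  have h3 : ((N : ℝ) - 3 * m) ^ (3 * m) ≤ W := by
    have : ((N - 3 * m : ℕ) : ℝ) = (N : ℝ) - 3 * m := by
      rw [Nat.cast_sub (by omega)]; push_cast; ring
    rw [← this]
    exact_mod_cast h2
  have hm' : 1200 * (m : ℝ) ≤ N := by exact_mod_cast hm
  -- Disjointness costs a factor (399/400)³ per triple, as 3m ≤ N/400, and (127/126)(62/3) <
  -- 21(399/400)³.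
  have hbase : (1 + 1 / 126) * (62 / 3 * (N : ℝ) ^ 3) ≤ 21 * ((N : ℝ) - 3 * m) ^ 3 := by
    have h4 : (399 / 400 * (N : ℝ)) ^ 3 ≤ ((N : ℝ) - 3 * m) ^ 3 :=
      pow_le_pow_left₀ (by positivity) (by linarith) 3
    have h5 : (0 : ℝ) < (N : ℝ) ^ 3 := by positivity
    rw [mul_pow] at h4
    nlinarith
  have h6 : (1 + 1 / 126) ^ m * (62 / 3 * (N : ℝ) ^ 3) ^ m ≤ W * 21 ^ m := by
    rw [← mul_pow]
    calc _ ≤ (21 * ((N : ℝ) - 3 * m) ^ 3) ^ m := pow_le_pow_left₀ (by positivity) hbase m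
      _ = ((N : ℝ) - 3 * m) ^ (3 * m) * 21 ^ m := by rw [mul_pow, ← pow_mul, mul_comm]
      _ ≤ _ := mul_le_mul_of_nonneg_right h3 (by positivity)
  have h7 : (0 : ℝ) < (62 / 3 * (N : ℝ) ^ 3) ^ m := by positivity
  refine le_of_mul_le_mul_right ?_ h7
  calc _ = |δ| * ((1 + 1 / 126) ^ m * (62 / 3 * (N : ℝ) ^ 3) ^ m) := by ring
    _ ≤ |δ| * (W * 21 ^ m) := mul_le_mul_of_nonneg_left h6 (abs_nonneg δ)
    _ ≤ _ := h1

end Bounds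

/-! ### Choice of constants -/

theorem two_rpow_div_le_pow (m : ℕ) : (2 : ℝ) ^ ((m : ℝ) / 126) ≤ (1 + 1 / 126) ^ m := by
  have h1 : (2 : ℝ) ≤ (1 + 1 / 126) ^ 126 := by
    have := one_add_mul_le_pow (a := (1 / 126 : ℝ)) (by norm_num) 126
    norm_num at this ⊢
  have h2 : (2 : ℝ) ^ ((126 : ℝ)⁻¹) ≤ 1 + 1 / 126 := by
    calc (2 : ℝ) ^ ((126 : ℝ)⁻¹) ≤ ((1 + 1 / 126 : ℝ) ^ 126) ^ ((126 : ℝ)⁻¹) :=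
          Real.rpow_le_rpow (by norm_num) h1 (by norm_num)
      _ = 1 + 1 / 126 := by
          exact_mod_cast Real.pow_rpow_inv_natCast (n := 126) (by norm_num : (0 : ℝ) ≤ 1 + 1 / 126)
            (by norm_num)
  calc (2 : ℝ) ^ ((m : ℝ) / 126) = ((2 : ℝ) ^ ((126 : ℝ)⁻¹)) ^ m := by
        rw [← Real.rpow_natCast, ← Real.rpow_mul (by norm_num), div_eq_inv_mul]
    _ ≤ _ := pow_le_pow_left₀ (by positivity) h2 m

/-- Monotone circuits for `F + δ ST` have exponential size unless `δ` is exponentially small. -/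
theorem two_rpow_le_size {n : ℕ} [NeZero n] (hn : 1000000 ≤ n) {ε δ : ℝ} (hδ : |δ| = ε)
    (hε : (2 : ℝ) ^ (-(1 / 1000000 * (n : ℝ))) ≤ ε) (C : MonotoneCircuit (Fin n × Fin n))
    (hC : C.Computes (fullSetMultilinear (Fin n) 0
      + MvPolynomial.C δ * spanningTreePoly (⊤ : SimpleGraph (Fin n)) 0)) :
    (2 : ℝ) ^ (1 / 1000000 * (n : ℝ)) ≤ (C.size : ℝ) := by
  have hcard : Fintype.card {v : Fin n // v ≠ 0} = n - 1 := by
    rw [Fintype.card_subtype_compl]; simp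
  set m := (n - 1) / 1200 with hm
  have h1 := abs_mul_pow_le_size C hC (by rw [hcard]; omega) (m := m) (by rw [hcard]; omega)
  rw [hδ] at h1
  have hn' : (1000000 : ℝ) ≤ n := by exact_mod_cast hn
  set t := (2 : ℝ) ^ (1 / 1000000 * (n : ℝ)) with ht
  have ht2 : 2 ≤ t := by
    calc (2 : ℝ) = 2 ^ (1 : ℝ) := (Real.rpow_one 2).symm
      _ ≤ t := Real.rpow_le_rpow_of_exponent_le (by norm_num) (by linarith)
  -- Here 5·1200·126 < 10⁶. One factor t pays for ε ≥ 1/t; the others absorb the constants.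
  have hρ : t ^ 5 ≤ (1 + 1 / 126) ^ m := by
    refine le_trans ?_ (two_rpow_div_le_pow m)
    rw [ht, ← Real.rpow_natCast, ← Real.rpow_mul (by norm_num)]
    refine Real.rpow_le_rpow_of_exponent_le (by norm_num) ?_
    have h2 : n ≤ 1200 * m + 1200 := by omega
    have h3 : (n : ℝ) ≤ 1200 * m + 1200 := by exact_mod_cast h2
    push_cast
    linarith
  rw [Real.rpow_neg (by norm_num), ← ht] at hε
  have ht0 : 0 < t := by linarith
  have hs : (0 : ℝ) ≤ C.size := Nat.cast_nonneg _
  have hε0 : 0 < ε := lt_of_lt_of_le (inv_pos.2 ht0) hε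
  have h4 : t ^ 4 ≤ 2 * C.size + 1 := by
    have h5 : ε * t ^ 5 ≤ C.size * (1 + ε) + 1 :=
      (mul_le_mul_of_nonneg_left hρ hε0.le).trans h1
    rcases le_total ε 1 with h6 | h6
    · have h7 : t ^ 4 ≤ ε * t ^ 5 := by
        calc t ^ 4 = t⁻¹ * t ^ 5 := by field_simp
          _ ≤ _ := mul_le_mul_of_nonneg_right hε (by positivity)
      nlinarith
    · have h7 : t ^ 4 ≤ t ^ 5 := pow_le_pow_right₀ (by linarith) (by norm_num)
      refine h7.trans (le_of_mul_le_mul_left ?_ hε0)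
      nlinarith
  have h8 : 8 * t ≤ t ^ 4 := by
    have : (2 : ℝ) ^ 3 ≤ t ^ 3 := pow_le_pow_left₀ (by norm_num) ht2 3
    nlinarith
  linarith

end

theorem theorem2 :
    ∃ η : ℝ, 0 < η ∧ ∃ c : ℝ, 0 < c ∧ ∃ n₀ : ℕ, ∀ (n : ℕ) [NeZero n], n₀ ≤ n →
      ∀ ε : ℝ, (2 : ℝ) ^ (-(η * (n : ℝ))) ≤ ε →
        (∀ C : MonotoneCircuit (Fin n × Fin n),
          C.Computes (fullSetMultilinear (Fin n) 0
            - MvPolynomial.C ε * spanningTreePoly (⊤ : SimpleGraph (Fin n)) 0) →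
          (2 : ℝ) ^ (c * (n : ℝ)) ≤ (C.size : ℝ)) ∧
        (∀ C : MonotoneCircuit (Fin n × Fin n),
          C.Computes (fullSetMultilinear (Fin n) 0
            + MvPolynomial.C ε * spanningTreePoly (⊤ : SimpleGraph (Fin n)) 0) →
          (2 : ℝ) ^ (c * (n : ℝ)) ≤ (C.size : ℝ)) := by
  refine ⟨1 / 1000000, by norm_num, 1 / 1000000, by norm_num, 1000000, fun n _ hn ε hε => ?_⟩
  have hε0 : 0 < ε := lt_of_lt_of_le (by positivity) hε
  refine ⟨fun C hC => ?_, fun C hC => two_rpow_le_size hn (abs_of_pos hε0) hε C hC⟩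
  refine two_rpow_le_size hn ((abs_neg ε).trans (abs_of_pos hε0)) hε C ?_
  rwa [map_neg, neg_mul, ← sub_eq_add_neg]
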